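/- Let $n \in \mathbb{N}$ and let the symmetric group $\mathfrak{S}_n$ be partially ordered by the Bruhat order: $u \le v$ if and only if there is a (possibly empty) directed path from $u$ to $v$ in the graph on $\mathfrak{S}_n$ with an edge $x \to y$ whenever $y x^{-1}$ is a transposition and $\ell(x) < \ell(y)$, where $\ell$ is the Coxeter length with respect to the simple transpositions $(i\; i+1)$, $1 \le i \le n-1$. Write $x \lhd y$ if $y$ covers $x$ in this order. For a saturated chain $\mathcal{C} = (x_0 \lhd x_1 \lhd \cdots \lhd x_d)$ and $1 \le i \le d-1$, the flip of $\mathcal{C}$ at $i$ is the chain $(x_0, \ldots, x_{i-1}, y_i, x_{i+1}, \ldots, x_d)$, where $y_i$ is the unique element with $x_{i-1} \lhd y_i \lhd x_{i+1}$ and $y_i \ne x_i$. Let $u, v \in \mathfrak{S}_n$ with $u \le v$. Then for any two maximal chains $\mathcal{C}$ and $\mathcal{D}$ in the Bruhat interval $[u,v] = \{w : u \le w \le v\}$, there is a finite (possibly empty) sequence of flips that transforms $\mathcal{C}$ into $\mathcal{D}$. -/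

import Mathlib

namespace Bruhat

/-- The simple transpositions `(i i+1)` of the symmetric group on `Fin n`. -/
def simpleTranspositions (n : ℕ) : Set (Equiv.Perm (Fin n)) :=
  {s | ∃ i j : Fin n, (i : ℕ) + 1 = (j : ℕ) ∧ s = Equiv.swap i j}

/-- The Coxeter length: the least `k` such that `w` is a product of `k` simple transpositions.
(Such a `k` exists, see `isLeast_coxeterLength`.) -/
noncomputable def coxeterLength {n : ℕ} (w : Equiv.Perm (Fin n)) : ℕ :=
  sInf {k | ∃ l : List (Equiv.Perm (Fin n)),
    (∀ s ∈ l, s ∈ simpleTranspositions n) ∧ l.prod = w ∧ l.length = k}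

/-- The inversions of `w`: pairs of positions `i < j` with `w i > w j`. -/
def inversions {n : ℕ} (w : Equiv.Perm (Fin n)) : Finset (Fin n × Fin n) :=
  Finset.univ.filter fun p => p.1 < p.2 ∧ w p.2 < w p.1

theorem mem_inversions {n : ℕ} (w : Equiv.Perm (Fin n)) (p : Fin n × Fin n) :
    p ∈ inversions w ↔ p.1 < p.2 ∧ w p.2 < w p.1 := by
  simp [inversions]

theorem swap_lt_swap {n : ℕ} {a b i j : Fin n} (hab : (a : ℕ) + 1 = b) (hij : i < j)
    (hne : ¬ (i = a ∧ j = b)) : Equiv.swap a b i < Equiv.swap a b j := by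
  simp only [Equiv.swap_apply_def]
  split_ifs <;> simp only [Fin.lt_def, Fin.ext_iff] at * <;> omega

theorem card_inversions_mul_le {n : ℕ} (w : Equiv.Perm (Fin n)) {a b : Fin n}
    (hab : (a : ℕ) + 1 = b) :
    (inversions (w * Equiv.swap a b)).card ≤ (inversions w).card + 1 := by
  have h : ((inversions (w * Equiv.swap a b)).erase (a, b)).card ≤ (inversions w).card := by
    refine Finset.card_le_card_of_injOn
      (fun p => (Equiv.swap a b p.1, Equiv.swap a b p.2)) ?_ ?_
    · rintro ⟨i, j⟩ hp
      rw [Finset.mem_coe, Finset.mem_erase, mem_inversions] at hp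
      rw [Finset.mem_coe, mem_inversions]
      simp only [ne_eq, Prod.mk.injEq, Equiv.Perm.mul_apply] at hp ⊢
      exact ⟨swap_lt_swap hab hp.2.1 hp.1, hp.2.2⟩
    · rintro ⟨i, j⟩ _ ⟨i', j'⟩ _ h
      simpa using h
  have := Finset.pred_card_le_card_erase (s := inversions (w * Equiv.swap a b)) (a := (a, b))
  omega

theorem card_inversions_mul_lt {n : ℕ} (w : Equiv.Perm (Fin n)) {a b : Fin n}
    (hab : (a : ℕ) + 1 = b) (hw : w b < w a) :
    (inversions (w * Equiv.swap a b)).card < (inversions w).card := by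
  have hlt : a < b := by rw [Fin.lt_def]; omega
  have hmem : (a, b) ∈ inversions w := by simp [inversions, hlt, hw]
  refine lt_of_le_of_lt ?_ (Finset.card_erase_lt_of_mem hmem)
  refine Finset.card_le_card_of_injOn
    (fun p => (Equiv.swap a b p.1, Equiv.swap a b p.2)) ?_ ?_
  · rintro ⟨i, j⟩ hp
    rw [Finset.mem_coe, mem_inversions] at hp
    rw [Finset.mem_coe, Finset.mem_erase, mem_inversions]
    simp only [ne_eq, Prod.mk.injEq, Equiv.Perm.mul_apply] at hp ⊢
    have hne : ¬ (i = a ∧ j = b) := by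
      rintro ⟨rfl, rfl⟩
      rw [Equiv.swap_apply_left, Equiv.swap_apply_right] at hp
      exact absurd hp.2 (not_lt.mpr hw.le)
    refine ⟨?_, swap_lt_swap hab hp.1 hne, hp.2⟩
    rintro ⟨h1, h2⟩
    rw [Equiv.swap_apply_eq_iff, Equiv.swap_apply_left] at h1
    rw [Equiv.swap_apply_eq_iff, Equiv.swap_apply_right] at h2
    subst h1 h2
    exact absurd hp.1 (not_lt.mpr hlt.le)
  · rintro ⟨i, j⟩ _ ⟨i', j'⟩ _ h
    simpa using h

theorem exists_descent {n : ℕ} {w : Equiv.Perm (Fin n)} (hw : w ≠ 1) :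
    ∃ a b : Fin n, (a : ℕ) + 1 = b ∧ w b < w a := by
  by_contra! h
  apply hw
  have hmono : StrictMono w := by
    cases n with
    | zero => intro i; exact i.elim0
    | succ m =>
      rw [Fin.strictMono_iff_lt_succ]
      intro i
      exact lt_of_le_of_ne (h i.castSucc i.succ (by simp))
        (fun he => (Fin.castSucc_lt_succ (i := i)).ne (w.injective he))
  have hs : (hmono.orderIsoOfSurjective w w.surjective) = OrderIso.refl (Fin n) :=
    Subsingleton.elim _ _
  ext i
  exact congrArg Fin.val (DFunLike.congr_fun hs i)

/-- The number of inversions of `w` is the least length of a word in the simple transpositions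
with product `w`. -/
theorem isLeast_card_inversions {n : ℕ} (w : Equiv.Perm (Fin n)) :
    IsLeast {k | ∃ l : List (Equiv.Perm (Fin n)),
      (∀ s ∈ l, s ∈ simpleTranspositions n) ∧ l.prod = w ∧ l.length = k}
      (inversions w).card := by
  have lower : ∀ l : List (Equiv.Perm (Fin n)), (∀ s ∈ l, s ∈ simpleTranspositions n) →
      (inversions l.prod).card ≤ l.length := by
    intro l
    induction l using List.reverseRecOn with
    | nil =>
      intro _
      rw [List.prod_nil, List.length_nil, Nat.le_zero, Finset.card_eq_zero,
        Finset.eq_empty_iff_forall_notMem]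
      intro p hp
      obtain ⟨h1, h2⟩ := (mem_inversions 1 p).mp hp
      exact absurd h1 (not_lt.mpr (le_of_lt h2))
    | append_singleton l s ih =>
      intro hl
      obtain ⟨a, b, hab, rfl⟩ := hl s (by simp)
      have := ih (fun t ht => hl t (by simp [ht]))
      have h2 := card_inversions_mul_le l.prod hab
      simp only [List.prod_append, List.prod_singleton, List.length_append, List.length_singleton]
      omega
  have upper : ∀ m (w : Equiv.Perm (Fin n)), (inversions w).card = m →
      ∃ l : List (Equiv.Perm (Fin n)),
        (∀ s ∈ l, s ∈ simpleTranspositions n) ∧ l.prod = w ∧ l.length ≤ m := by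
    intro m
    induction m using Nat.strong_induction_on with
    | _ m ih =>
      intro w hm
      by_cases hw : w = 1
      · exact ⟨[], by simp, by simp [hw], by simp⟩
      · obtain ⟨a, b, hab, hd⟩ := exists_descent hw
        have hlt := card_inversions_mul_lt w hab hd
        rw [hm] at hlt
        obtain ⟨l, h1, h2, h3⟩ := ih _ hlt _ rfl
        refine ⟨l ++ [Equiv.swap a b], ?_, ?_, ?_⟩
        · intro s hs
          rcases List.mem_append.mp hs with hs | hs
          · exact h1 s hs
          · exact ⟨a, b, hab, by simpa using hs⟩
        · simp [h2, mul_assoc]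
        · simp only [List.length_append, List.length_singleton]
          omega
  constructor
  · obtain ⟨l, h1, h2, h3⟩ := upper _ w rfl
    have := lower l h1
    rw [h2] at this
    exact ⟨l, h1, h2, le_antisymm h3 this⟩
  · rintro k ⟨l, h1, rfl, rfl⟩
    exact lower l h1

theorem coxeterLength_eq_card_inversions {n : ℕ} (w : Equiv.Perm (Fin n)) :
    coxeterLength w = (inversions w).card :=
  (isLeast_card_inversions w).csInf_eq

theorem isLeast_coxeterLength {n : ℕ} (w : Equiv.Perm (Fin n)) :
    IsLeast {k | ∃ l : List (Equiv.Perm (Fin n)),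
      (∀ s ∈ l, s ∈ simpleTranspositions n) ∧ l.prod = w ∧ l.length = k} (coxeterLength w) := by
  rw [coxeterLength_eq_card_inversions]
  exact isLeast_card_inversions w

/-- The edges `u → v` of the Bruhat graph: `v u⁻¹` is a transposition and `ℓ(u) < ℓ(v)`. -/
def Edge {n : ℕ} (u v : Equiv.Perm (Fin n)) : Prop :=
  (v * u⁻¹).IsSwap ∧ coxeterLength u < coxeterLength v

theorem length_le_of_reflTransGen {n : ℕ} {u v : Equiv.Perm (Fin n)}
    (h : Relation.ReflTransGen Edge u v) : u = v ∨ coxeterLength u < coxeterLength v := by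
  induction h with
  | refl => exact Or.inl rfl
  | tail _ hbc ih =>
    rcases ih with rfl | ih
    · exact Or.inr hbc.2
    · exact Or.inr (ih.trans hbc.2)

/-- The Bruhat order on the symmetric group: `u ≤ v` if and only if there is a (possibly empty)
directed path from `u` to `v` in the Bruhat graph. -/
instance bruhatOrder (n : ℕ) : PartialOrder (Equiv.Perm (Fin n)) where
  le u v := Relation.ReflTransGen Edge u v
  le_refl _ := Relation.ReflTransGen.refl
  le_trans _ _ _ := Relation.ReflTransGen.trans
  le_antisymm u v huv hvu := by
    rcases length_le_of_reflTransGen huv with h | h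
    · exact h
    · rcases length_le_of_reflTransGen hvu with h' | h'
      · exact h'.symm
      · exact absurd h (not_lt.mpr h'.le)

/-- `D` is a flip of the maximal chain `C`: for some consecutive elements `a ⋖ x ⋖ b` of `C`, the
chain `D` is obtained from `C` by replacing `x` by `y`, where `y` is the unique element other
than `x` such that `a ⋖ y ⋖ b`. (`Flag α` is the type of maximal chains of `α`.) -/
def IsFlip {α : Type*} [PartialOrder α] (C D : Flag α) : Prop :=
  ∃ a x b y : α, a ∈ C ∧ x ∈ C ∧ b ∈ C ∧ a ⋖ x ∧ x ⋖ b ∧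
    (a ⋖ y ∧ y ⋖ b ∧ y ≠ x) ∧ (∀ z : α, a ⋖ z → z ⋖ b → z ≠ x → z = y) ∧
    (D : Set α) = insert y ((C : Set α) \ {x})

end Bruhat

namespace Bruhat

section SaturatedChains

variable {α Λ : Type*} [PartialOrder α]

/-- `IsSaturated u v l`: the list `l` is a saturated chain from `u` to `v`. -/
inductive IsSaturated (v : α) : α → List α → Prop
  | nil : IsSaturated v v [v]
  | cons {u w : α} {l : List α} : u ⋖ w → IsSaturated v w (w :: l) →
      IsSaturated v u (u :: w :: l)

/-- The element `y` is the unique element other than `x` strictly between `a` and `b`, where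
`a ⋖ x ⋖ b`. -/
structure IsFlipAt (a x b y : α) : Prop where
  left : a ⋖ x
  right : x ⋖ b
  left' : a ⋖ y
  right' : y ⋖ b
  ne : y ≠ x
  unique : ∀ z, a ⋖ z → z ⋖ b → z ≠ x → z = y

theorem IsFlipAt.symm {a x b y : α} (h : IsFlipAt a x b y) : IsFlipAt a y b x :=
  ⟨h.left', h.right', h.left, h.right, h.ne.symm, fun z h1 h2 h3 => by
    by_contra hz
    exact h3 (h.unique z h1 h2 hz)⟩

/-- Flips of saturated chains, written as lists. -/
inductive ListFlip : List α → List α → Prop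
  | head {a x b y : α} (l : List α) : IsFlipAt a x b y →
      ListFlip (a :: x :: b :: l) (a :: y :: b :: l)
  | cons (a : α) {l m : List α} : ListFlip l m → ListFlip (a :: l) (a :: m)

theorem ListFlip.symm {l m : List α} (h : ListFlip l m) : ListFlip m l := by
  induction h with
  | head l h => exact .head l h.symm
  | cons a _ ih => exact .cons a ih

theorem IsSaturated.exists_eq_cons {u v : α} {l : List α} (h : IsSaturated v u l) :
    ∃ t, l = u :: t := by
  cases h <;> exact ⟨_, rfl⟩

theorem IsSaturated.le {u v : α} {l : List α} (h : IsSaturated v u l) : u ≤ v := by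
  induction h with
  | nil => exact le_rfl
  | cons h _ ih => exact h.le.trans ih

theorem IsSaturated.mem_Icc {u v : α} {l : List α} (h : IsSaturated v u l) :
    ∀ x ∈ l, u ≤ x ∧ x ≤ v := by
  induction h with
  | nil => simp
  | cons h hl ih =>
    intro x hx
    rcases List.mem_cons.mp hx with rfl | hx
    · exact ⟨le_rfl, h.le.trans hl.le⟩
    · exact ⟨h.le.trans (ih x hx).1, (ih x hx).2⟩

theorem IsSaturated.of_listFlip {u v : α} {l m : List α} (h : IsSaturated v u l)
    (hf : ListFlip l m) : IsSaturated v u m := by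
  induction hf generalizing u with
  | head l hf =>
    cases h with
    | cons _ h => cases h with
      | cons _ h => exact .cons hf.left' (.cons hf.right' h)
  | cons a hf ih =>
    cases h with
    | nil => cases hf
    | cons h hl =>
      have := ih hl
      obtain ⟨t, rfl⟩ := this.exists_eq_cons
      exact .cons h this

theorem ListFlip.length_eq {l m : List α} (h : ListFlip l m) : m.length = l.length := by
  induction h with
  | head => rfl
  | cons _ _ ih => simp [ih]

theorem ListFlip.length_eq_of_reflTransGen {l m : List α}
    (h : Relation.ReflTransGen ListFlip l m) : m.length = l.length := by
  induction h with
  | refl => rfl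
  | tail _ h ih => rw [h.length_eq, ih]

/-- The labels of the pairs of consecutive elements of the list strictly increase. -/
inductive IsRising [LT Λ] (lab : α → α → Λ) : List α → Prop
  | singleton (u : α) : IsRising lab [u]
  | pair (u w : α) : IsRising lab [u, w]
  | cons {u w x : α} {l : List α} : lab u w < lab w x → IsRising lab (w :: x :: l) →
      IsRising lab (u :: w :: x :: l)

theorem IsSaturated.exists_isRising [LT Λ] [WellFoundedLT Λ] {lab : α → α → Λ}
    (hlab : ∀ x y z : α, x ⋖ y → y ⋖ z → ¬ lab x y < lab y z →
      ∃ y', lab x y' < lab x y ∧ IsFlipAt x y z y')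
    {u v : α} {l : List α} (h : IsSaturated v u l) :
    ∃ r, IsSaturated v u r ∧ IsRising lab r ∧ Relation.ReflTransGen ListFlip l r := by
  obtain ⟨k, hk⟩ : ∃ k, l.length = k := ⟨_, rfl⟩
  induction k generalizing u l with
  | zero => cases h <;> simp at hk
  | succ k ih =>
    obtain _ | ⟨huw, hl⟩ := h
    · exact ⟨[v], .nil, .singleton v, .refl⟩
    rename_i w t
    obtain ⟨c, hc⟩ : ∃ c, lab u w = c := ⟨_, rfl⟩
    induction c using WellFoundedLT.induction generalizing w t with
    | ind c ihc =>
      obtain ⟨r, hr, hrise, hflip⟩ := ih hl (by simpa using hk)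
      have hflip' : Relation.ReflTransGen ListFlip (u :: w :: t) (u :: r) :=
        hflip.lift (List.cons u) (fun _ _ => ListFlip.cons u)
      cases hr with
      | nil => exact ⟨_, .cons huw .nil, .pair u v, hflip'⟩
      | @cons _ x r hwx hr =>
        by_cases hlt : lab u w < lab w x
        · exact ⟨_, .cons huw (.cons hwx hr), .cons hlt hrise, hflip'⟩
        · obtain ⟨y, hy, hf⟩ := hlab u w x huw hwx hlt
          have hlen : (u :: w :: x :: r).length = k + 1 := by
            rw [← hk]
            exact ListFlip.length_eq_of_reflTransGen hflip'
          obtain ⟨s, hs, hsr, hsf⟩ := ihc (lab u y) (hc ▸ hy) (.cons hf.right' hr)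
            hf.left' (by simpa using hlen) rfl
          exact ⟨s, hs, hsr, (hflip'.tail (.head r hf)).trans hsf⟩

theorem IsSaturated.eq_of_isRising [LT Λ] {lab : α → α → Λ}
    (hlab : ∀ {u w w' v : α} {l l' : List α}, IsSaturated v u (u :: w :: l) →
      IsRising lab (u :: w :: l) → IsSaturated v u (u :: w' :: l') →
      IsRising lab (u :: w' :: l') → w = w')
    {u v : α} {l m : List α} (hl : IsSaturated v u l) (hl' : IsRising lab l)
    (hm : IsSaturated v u m) (hm' : IsRising lab m) : l = m := by
  induction hl generalizing m with
  | nil =>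
    cases hm with
    | nil => rfl
    | cons h h' => exact absurd h'.le h.lt.not_ge
  | @cons u w l h h' ih =>
    cases hm with
    | nil => exact absurd h'.le h.lt.not_ge
    | cons g g' =>
      obtain rfl := hlab (.cons h h') hl' (.cons g g') hm'
      rw [ih (by cases hl' <;> first | assumption | exact .singleton _) g'
        (by cases hm' <;> first | assumption | exact .singleton _)]

/-- Two saturated chains with the same end points are connected by flips as soon as the edges
are labelled such that every non-rising pair of edges can be flipped to one with a smaller first
label, and a rising chain is determined by its end points. -/
theorem IsSaturated.reflTransGen_listFlip [LT Λ] [WellFoundedLT Λ] {lab : α → α → Λ}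
    (hflip : ∀ x y z : α, x ⋖ y → y ⋖ z → ¬ lab x y < lab y z →
      ∃ y', lab x y' < lab x y ∧ IsFlipAt x y z y')
    (huniq : ∀ {u w w' v : α} {l l' : List α}, IsSaturated v u (u :: w :: l) →
      IsRising lab (u :: w :: l) → IsSaturated v u (u :: w' :: l') →
      IsRising lab (u :: w' :: l') → w = w')
    {u v : α} {l m : List α} (hl : IsSaturated v u l) (hm : IsSaturated v u m) :
    Relation.ReflTransGen ListFlip l m := by
  obtain ⟨r, hr, hr', hlr⟩ := hl.exists_isRising hflip
  obtain ⟨s, hs, hs', hms⟩ := hm.exists_isRising hflip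
  obtain rfl := hr.eq_of_isRising huniq hr' hs hs'
  have : Std.Symm (ListFlip (α := α)) := ⟨fun _ _ => ListFlip.symm⟩
  exact hlr.trans (symm_of (Relation.ReflTransGen ListFlip) hms)

theorem IsSaturated.mem_of_comparable {u v : α} {l : List α} (h : IsSaturated v u l) {z : α}
    (huz : u ≤ z) (hzv : z ≤ v) (hz : ∀ x ∈ l, x ≤ z ∨ z ≤ x) : z ∈ l := by
  induction h with
  | nil => simp [le_antisymm hzv huz]
  | @cons u w l h h' ih =>
    rcases hz w (by simp) with hw | hw
    · exact List.mem_cons_of_mem _ (ih hw fun x hx => hz x (List.mem_cons_of_mem _ hx))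
    · rcases h.eq_or_eq huz hw with rfl | rfl <;> simp

theorem IsSaturated.comparable {u v : α} {l : List α} (h : IsSaturated v u l) :
    ∀ x ∈ l, ∀ y ∈ l, x ≤ y ∨ y ≤ x := by
  induction h with
  | nil => simp
  | @cons u w l h h' ih =>
    have hu : ∀ x ∈ w :: l, u ≤ x := fun x hx => h.le.trans (h'.mem_Icc x hx).1
    intro x hx y hy
    rcases List.mem_cons.mp hx with rfl | hx' <;> rcases List.mem_cons.mp hy with rfl | hy'
    · exact Or.inl le_rfl
    · exact Or.inl (hu y hy')
    · exact Or.inr (hu x hx')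
    · exact ih x hx' y hy'

theorem IsSaturated.exists_flag {u v : α} {l : List α} (h : IsSaturated v u l) :
    ∃ C : Flag (Set.Icc u v), ∀ x, x ∈ C ↔ (x : α) ∈ l := by
  refine ⟨⟨{x | (x : α) ∈ l}, fun x hx y hy _ => h.comparable x hx y hy, ?_⟩, fun x => Iff.rfl⟩
  intro s hs hls
  refine Set.Subset.antisymm hls fun z hz => ?_
  refine h.mem_of_comparable z.2.1 z.2.2 fun x hx => ?_
  have := h.mem_Icc x hx
  exact hs.total (hls (show (⟨x, this⟩ : Set.Icc u v) ∈ _ from hx)) hz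

theorem covBy_Icc_iff {u v : α} {x y : Set.Icc u v} : x ⋖ y ↔ (x : α) ⋖ y :=
  (Set.OrdConnected.apply_covBy_apply_iff (OrderEmbedding.subtype (· ∈ Set.Icc u v))
    (by simpa only [OrderEmbedding.subtype_apply, Subtype.range_coe_subtype, Set.ofPred_mem_eq,
      OrderEmbedding.coe_subtype] using Set.ordConnected_Icc)).symm

theorem _root_.Flag.exists_isSaturated [Finite α] {u v : α} (huv : u ≤ v)
    (C : Flag (Set.Icc u v)) :
    ∃ l, IsSaturated v u l ∧ ∀ x : Set.Icc u v, x ∈ C ↔ (x : α) ∈ l := by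
  have : Fact (u ≤ v) := ⟨huv⟩
  have key : ∀ w : Set.Icc u v, w ∈ C → ∃ l, IsSaturated v w l ∧
      ∀ x : Set.Icc u v, (x ∈ C ∧ w ≤ x) ↔ (x : α) ∈ l := by
    intro w
    induction w using WellFoundedGT.induction with
    | ind w ih =>
      intro hw
      by_cases hv : (w : α) = v
      · refine ⟨[v], by rw [hv]; exact .nil, fun x => ?_⟩
        rw [List.mem_singleton]
        constructor
        · rintro ⟨_, hx⟩
          exact le_antisymm x.2.2 (hv.symm.le.trans hx)
        · intro hx
          obtain rfl : x = w := Subtype.ext (hx.trans hv.symm)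
          exact ⟨hw, le_rfl⟩
      · have hne : {y | y ∈ C ∧ w < y}.Nonempty :=
          ⟨⟨v, huv, le_rfl⟩, C.top_mem, lt_of_le_of_ne w.2.2 (fun h => hv (by rw [h]))⟩
        obtain ⟨y, ⟨hyC, hwy⟩, hmin⟩ := Set.Finite.exists_minimal (Set.toFinite _) hne
        have hcov : w ⋖ y := by
          refine (Flag.coe_covBy_coe (s := C) (a := ⟨w, hw⟩) (b := ⟨y, hyC⟩)).mpr ⟨hwy, ?_⟩
          intro z hz1 hz2
          exact absurd (hmin ⟨z.2, hz1⟩ hz2.le) hz2.not_ge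
        obtain ⟨l, hl, hmem⟩ := ih y hwy hyC
        obtain ⟨t, rfl⟩ := hl.exists_eq_cons
        refine ⟨_, .cons (covBy_Icc_iff.mp hcov) hl, fun x => ?_⟩
        rw [List.mem_cons, ← hmem, ← Subtype.ext_iff]
        constructor
        · rintro ⟨hx, hwx⟩
          rcases hwx.eq_or_lt with rfl | hlt
          · exact Or.inl rfl
          · refine Or.inr ⟨hx, ?_⟩
            rcases C.le_or_le hyC hx with h | h
            · exact h
            · exact hmin ⟨hx, hlt⟩ h
        · rintro (rfl | ⟨hx, hyx⟩)
          · exact ⟨hw, le_rfl⟩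
          · exact ⟨hx, hwy.le.trans hyx⟩
  obtain ⟨l, hl, h⟩ := key ⊥ C.bot_mem
  exact ⟨l, hl, fun x => by rw [← h]; simp⟩

theorem ListFlip.exists_mem {l m : List α} {u v : α} (h : ListFlip l m) (hl : IsSaturated v u l) :
    ∃ a x b y, IsFlipAt a x b y ∧ a ∈ l ∧ x ∈ l ∧ b ∈ l ∧
      ∀ z, z ∈ m ↔ z = y ∨ z ∈ l ∧ z ≠ x := by
  induction h generalizing u with
  | @head a x b y t h =>
    refine ⟨a, x, b, y, h, by simp, by simp, by simp, fun z => ?_⟩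
    have h1 := h.left.lt.ne
    have h2 : ∀ z ∈ b :: t, z ≠ x := by
      cases hl with
      | cons _ hl => cases hl with
        | cons hxb hl =>
          rintro z hz rfl
          exact hxb.lt.not_ge (hl.mem_Icc _ hz).1
    simp only [List.mem_cons] at h2 ⊢
    grind
  | @cons c l m h ih =>
    cases hl with
    | nil => cases h
    | cons hc hl =>
      obtain ⟨a, x, b, y, hf, ha, hx, hb, hz⟩ := ih hl
      have : c ≠ x := by
        rintro rfl
        exact hc.lt.not_ge (hl.mem_Icc _ hx).1
      refine ⟨a, x, b, y, hf, List.mem_cons_of_mem _ ha, List.mem_cons_of_mem _ hx,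
        List.mem_cons_of_mem _ hb, fun z => ?_⟩
      rw [List.mem_cons, hz, List.mem_cons]
      grind

theorem ListFlip.isFlip {u v : α} {l m : List α} (h : ListFlip l m) (hl : IsSaturated v u l)
    {C D : Flag (Set.Icc u v)} (hC : ∀ x, x ∈ C ↔ (x : α) ∈ l) (hD : ∀ x, x ∈ D ↔ (x : α) ∈ m) :
    IsFlip C D := by
  obtain ⟨a, x, b, y, hf, ha, hx, hb, hz⟩ := h.exists_mem hl
  have ha' := hl.mem_Icc a ha
  have hx' := hl.mem_Icc x hx
  have hb' := hl.mem_Icc b hb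
  refine ⟨⟨a, ha'⟩, ⟨x, hx'⟩, ⟨b, hb'⟩, ⟨y, ha'.1.trans hf.left'.le, hf.right'.le.trans hb'.2⟩,
    (hC _).mpr ha, (hC _).mpr hx, (hC _).mpr hb, covBy_Icc_iff.mpr hf.left,
    covBy_Icc_iff.mpr hf.right, ⟨covBy_Icc_iff.mpr hf.left', covBy_Icc_iff.mpr hf.right',
      fun h => hf.ne (Subtype.ext_iff.mp h)⟩, fun z h1 h2 h3 => ?_, ?_⟩
  · exact Subtype.ext (hf.unique z (covBy_Icc_iff.mp h1) (covBy_Icc_iff.mp h2)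
      fun h => h3 (Subtype.ext h))
  · ext z
    rw [SetLike.mem_coe, hD, hz, Set.mem_insert_iff, Set.mem_sdiff, SetLike.mem_coe, hC,
      Set.mem_singleton_iff, Subtype.ext_iff, Subtype.ext_iff]

theorem IsSaturated.reflTransGen_isFlip {u v : α} {l m : List α} (hl : IsSaturated v u l)
    (h : Relation.ReflTransGen ListFlip l m) {C D : Flag (Set.Icc u v)}
    (hC : ∀ x, x ∈ C ↔ (x : α) ∈ l) (hD : ∀ x, x ∈ D ↔ (x : α) ∈ m) :
    Relation.ReflTransGen IsFlip C D := by
  induction h using Relation.ReflTransGen.head_induction_on generalizing C with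
  | refl =>
    obtain rfl : C = D := SetLike.ext fun x => by rw [hC, hD]
    exact .refl
  | head h _ ih =>
    have hm := hl.of_listFlip h
    obtain ⟨E, hE⟩ := hm.exists_flag
    exact .head (h.isFlip hl hC hE) (ih hm hE)

end SaturatedChains

open Equiv

variable {n : ℕ}

/-- The positions `i < j` form a non-inversion of `x`, and no value of `x` at a position between
them lies between `x i` and `x j`. -/
def IsCoverPair (x : Perm (Fin n)) (i j : Fin n) : Prop :=
  i < j ∧ x i < x j ∧ ∀ k, i < k → k < j → ¬ (x i < x k ∧ x k < x j)

theorem swap_lt_swap_of_not_lt {i j p q : Fin n} (hij : i < j) (hpq : p < q)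
    (h : ¬ swap i j p < swap i j q) :
    (p = i ∧ q = j) ∨ (p = i ∧ i < q ∧ q < j) ∨ (q = j ∧ i < p ∧ p < j) := by
  simp only [swap_apply_def] at h
  split_ifs at h <;> simp only [Fin.lt_def, Fin.ext_iff] at * <;> omega

/-- The involution on pairs of positions which applies `swap i j` to both entries whenever this
preserves their order. -/
def swapPair (i j : Fin n) (p : Fin n × Fin n) : Fin n × Fin n :=
  if swap i j p.1 < swap i j p.2 then (swap i j p.1, swap i j p.2) else p

theorem swapPair_swapPair (i j : Fin n) {p : Fin n × Fin n} (hp : p.1 < p.2) :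
    swapPair i j (swapPair i j p) = p := by
  unfold swapPair
  split_ifs <;> simp_all

theorem swapPair_eq_iff {i j : Fin n} (hij : i < j) {p : Fin n × Fin n} (hp : p.1 < p.2) :
    swapPair i j p = (i, j) ↔ p = (i, j) := by
  have h : swapPair i j (i, j) = (i, j) := by simp [swapPair, hij.le]
  constructor
  · intro h'
    rw [← swapPair_swapPair i j hp, h', h]
  · rintro rfl
    exact h

theorem swapPair_injOn (i j : Fin n) (x : Perm (Fin n)) :
    Set.InjOn (swapPair i j) (inversions x) := by
  intro p hp q hq h
  rw [← swapPair_swapPair i j ((mem_inversions x p).mp hp).1, h,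
    swapPair_swapPair i j ((mem_inversions x q).mp hq).1]

theorem coxeterLength_lt_mul_swap {x : Perm (Fin n)} {i j : Fin n} (hij : i < j)
    (hx : x i < x j) : coxeterLength x < coxeterLength (x * swap i j) := by
  rw [coxeterLength_eq_card_inversions, coxeterLength_eq_card_inversions]
  have hmem : (i, j) ∈ inversions (x * swap i j) := by simp [mem_inversions, hij, hx]
  refine lt_of_le_of_lt ?_ (Finset.card_erase_lt_of_mem hmem)
  refine Finset.card_le_card_of_injOn (swapPair i j) ?_ (swapPair_injOn i j x)
  rintro ⟨p, q⟩ hp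
  rw [Finset.mem_coe, mem_inversions] at hp
  obtain ⟨hpq, hp⟩ := hp
  dsimp only at hpq hp
  rw [Finset.mem_coe, Finset.mem_erase, ne_eq, swapPair_eq_iff hij hpq, mem_inversions]
  refine ⟨by rintro ⟨⟩; exact absurd hp hx.not_gt, ?_⟩
  unfold swapPair
  split_ifs with h
  · simpa using ⟨h, hp⟩
  · refine ⟨hpq, ?_⟩
    rcases swap_lt_swap_of_not_lt hij hpq h with ⟨rfl, rfl⟩ | ⟨rfl, h1, h2⟩ | ⟨rfl, h1, h2⟩
    · exact absurd hp hx.not_gt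
    · simpa [swap_apply_of_ne_of_ne h1.ne' h2.ne] using hp.trans hx
    · simpa [swap_apply_of_ne_of_ne h1.ne' h2.ne] using hx.trans hp

theorem IsCoverPair.coxeterLength_le {x : Perm (Fin n)} {i j : Fin n} (h : IsCoverPair x i j) :
    coxeterLength (x * swap i j) ≤ coxeterLength x + 1 := by
  obtain ⟨hij, hx, hb⟩ := h
  rw [coxeterLength_eq_card_inversions, coxeterLength_eq_card_inversions]
  have hle : ((inversions (x * swap i j)).erase (i, j)).card ≤ (inversions x).card := by
    refine Finset.card_le_card_of_injOn (swapPair i j) ?_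
      ((swapPair_injOn i j (x * swap i j)).mono (Finset.coe_subset.mpr (Finset.erase_subset _ _)))
    rintro ⟨p, q⟩ hp
    rw [Finset.mem_coe, Finset.mem_erase, mem_inversions] at hp
    obtain ⟨hne, hpq, hp⟩ := hp
    dsimp only at hpq hp
    rw [Finset.mem_coe, mem_inversions]
    unfold swapPair
    split_ifs with h
    · exact ⟨h, hp⟩
    · refine ⟨hpq, ?_⟩
      rcases swap_lt_swap_of_not_lt hij hpq h with ⟨rfl, rfl⟩ | ⟨rfl, h1, h2⟩ | ⟨rfl, h1, h2⟩
      · exact absurd rfl hne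
      · have := hb q h1 h2
        have hn : x q ≠ x p := fun he => h1.ne' (x.injective he)
        simp only [Perm.mul_apply, swap_apply_left, swap_apply_of_ne_of_ne h1.ne' h2.ne] at hp ⊢
        grind
      · have := hb p h1 h2
        have hn : x p ≠ x q := fun he => h2.ne (x.injective he)
        simp only [Perm.mul_apply, swap_apply_right, swap_apply_of_ne_of_ne h1.ne' h2.ne] at hp ⊢
        grind
  have := Finset.pred_card_le_card_erase (s := inversions (x * swap i j)) (a := (i, j))
  omega

theorem edge_iff {x y : Perm (Fin n)} :
    Edge x y ↔ ∃ i j, i < j ∧ x i < x j ∧ y = x * swap i j := by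
  constructor
  · rintro ⟨⟨a, b, hab, h⟩, hlt⟩
    have key : ∀ i j : Fin n, i < j → y = x * swap i j → ∃ i j, i < j ∧ x i < x j ∧
        y = x * swap i j := by
      rintro i j hij rfl
      refine ⟨i, j, hij, ?_, rfl⟩
      by_contra hx
      have hx' : x j < x i := lt_of_le_of_ne (not_lt.mp hx) (fun he => hij.ne' (x.injective he))
      have := coxeterLength_lt_mul_swap (x := x * swap i j) hij (by simpa using hx')
      rw [mul_assoc, swap_mul_self, mul_one] at this
      exact absurd hlt this.not_gt
    have hy : y = x * swap (x⁻¹ a) (x⁻¹ b) := by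
      rw [mul_inv_eq_iff_eq_mul] at h
      rw [h, swap_mul_eq_mul_swap]
    rcases lt_trichotomy (x⁻¹ a) (x⁻¹ b) with h1 | h1 | h1
    · exact key _ _ h1 hy
    · exact absurd (x⁻¹.injective h1) hab
    · exact key _ _ h1 (by rw [hy, swap_comm])
  · rintro ⟨i, j, hij, hx, rfl⟩
    refine ⟨⟨x i, x j, hx.ne, ?_⟩, coxeterLength_lt_mul_swap hij hx⟩
    rw [mul_inv_eq_iff_eq_mul, mul_swap_eq_swap_mul]

theorem coxeterLength_strictMono : StrictMono (coxeterLength : Perm (Fin n) → ℕ) := by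
  intro x y h
  rcases length_le_of_reflTransGen h.le with h' | h'
  · exact absurd h' h.ne
  · exact h'

theorem Edge.lt {x y : Perm (Fin n)} (h : Edge x y) : x < y :=
  lt_of_le_of_ne (Relation.ReflTransGen.single h) (fun he => h.2.ne (by rw [he]))

theorem lt_mul_swap {x : Perm (Fin n)} {i j : Fin n} (hij : i < j) (hx : x i < x j) :
    x < x * swap i j :=
  Edge.lt (edge_iff.mpr ⟨i, j, hij, hx, rfl⟩)

theorem IsCoverPair.covBy {x : Perm (Fin n)} {i j : Fin n} (h : IsCoverPair x i j) :
    x ⋖ x * swap i j := by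
  refine ⟨lt_mul_swap h.1 h.2.1, fun w h1 h2 => ?_⟩
  have := coxeterLength_strictMono h1
  have := coxeterLength_strictMono h2
  have := h.coxeterLength_le
  omega

theorem covBy_iff {x y : Perm (Fin n)} :
    x ⋖ y ↔ ∃ i j, IsCoverPair x i j ∧ y = x * swap i j := by
  constructor
  · intro h
    obtain ⟨w, hxw, hwy⟩ : ∃ w, Edge x w ∧ w ≤ y := by
      rcases Relation.ReflTransGen.cases_head h.le with he | he
      · exact absurd he h.ne
      · exact he
    obtain rfl : w = y := by
      by_contra hne
      exact h.2 hxw.lt (lt_of_le_of_ne hwy hne)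
    obtain ⟨i, j, hij, hx, rfl⟩ := edge_iff.mp hxw
    refine ⟨i, j, ⟨hij, hx, fun k hik hkj hk => ?_⟩, rfl⟩
    have e : x * swap i j = x * swap i k * swap k j * swap i k := by
      rw [mul_assoc, mul_assoc]
      congr 1
      rw [swap_comm i k, swap_comm k j, ← mul_assoc, swap_mul_swap_mul_swap hkj.ne' hij.ne']
    refine h.2 (lt_mul_swap hik hk.1) ?_
    rw [e]
    refine (lt_mul_swap hkj ?_).trans (lt_mul_swap hik ?_)
    · simpa [swap_apply_of_ne_of_ne hij.ne' hkj.ne'] using hx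
    · simpa [swap_apply_of_ne_of_ne hik.ne hij.ne, swap_apply_of_ne_of_ne hij.ne' hkj.ne']
        using hk.2
  · rintro ⟨i, j, h, rfl⟩
    exact h.covBy

theorem mul_swap_apply_of_ne (x : Perm (Fin n)) {i j k : Fin n} (hi : k ≠ i) (hj : k ≠ j) :
    (x * swap i j) k = x k := by
  rw [Perm.mul_apply, swap_apply_of_ne_of_ne hi hj]

theorem mul_swap_apply_left (x : Perm (Fin n)) (i j : Fin n) : (x * swap i j) i = x j := by
  rw [Perm.mul_apply, swap_apply_left]

theorem mul_swap_apply_right (x : Perm (Fin n)) (i j : Fin n) : (x * swap i j) j = x i := by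
  rw [Perm.mul_apply, swap_apply_right]

open Classical in
/-- The label of a Bruhat cover `x ⋖ x * swap i j` with `i < j` is the pair `(i, j)`, with labels
ordered lexicographically. -/
noncomputable def edgeLabel (x y : Perm (Fin n)) : ℕ ×ₗ ℕ :=
  if h : ∃ p : Fin n × Fin n, p.1 < p.2 ∧ y = x * swap p.1 p.2 then
    toLex ((h.choose.1 : ℕ), (h.choose.2 : ℕ)) else toLex (0, 0)

theorem swap_injective_of_lt {i j a b : Fin n} (hij : i < j) (hab : a < b)
    (h : swap i j = swap a b) : i = a ∧ j = b := by
  have h1 := DFunLike.congr_fun h i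
  have h2 := DFunLike.congr_fun h j
  simp only [swap_apply_def] at h1 h2
  grind

theorem edgeLabel_mul_swap (x : Perm (Fin n)) {i j : Fin n} (hij : i < j) :
    edgeLabel x (x * swap i j) = toLex ((i : ℕ), (j : ℕ)) := by
  have h : ∃ p : Fin n × Fin n, p.1 < p.2 ∧ x * swap i j = x * swap p.1 p.2 := ⟨(i, j), hij, rfl⟩
  obtain ⟨h1, h2⟩ := swap_injective_of_lt hij h.choose_spec.1 (mul_left_cancel h.choose_spec.2)
  rw [edgeLabel, dif_pos h, ← h1, ← h2]

theorem edgeLabel_lt_iff {x y : Perm (Fin n)} {i j a b : Fin n} (hij : i < j) (hab : a < b) :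
    edgeLabel x (x * swap i j) < edgeLabel y (y * swap a b) ↔ i < a ∨ i = a ∧ j < b := by
  rw [edgeLabel_mul_swap x hij, edgeLabel_mul_swap y hab, Prod.Lex.toLex_lt_toLex]
  simp only [Fin.lt_def, Fin.ext_iff]

/-- The position `i` is the first where `u` and `v` differ, and `j` is the first position after
`i` at which the value of `u` belongs to the interval `(u i, v i]`. -/
structure IsFirstPair (u v : Perm (Fin n)) (i j : Fin n) : Prop where
  lt : i < j
  eq_of_lt : ∀ k < i, u k = v k
  apply_lt : u i < u j
  apply_le : u j ≤ v i
  not_between : ∀ k, i < k → k < j → ¬ (u i < u k ∧ u k ≤ v i)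

theorem IsFirstPair.unique {u v : Perm (Fin n)} {i j i' j' : Fin n} (h : IsFirstPair u v i j)
    (h' : IsFirstPair u v i' j') : i = i' ∧ j = j' := by
  obtain ⟨h1, h2, h3, h4, h5⟩ := h
  obtain ⟨g1, g2, g3, g4, g5⟩ := h'
  have hi : i = i' := by
    rcases lt_trichotomy i i' with h | h | h
    · exact absurd (g2 i h) (h3.trans_le h4).ne
    · exact h
    · exact absurd (h2 i' h) (g3.trans_le g4).ne
  subst hi
  refine ⟨rfl, ?_⟩
  rcases lt_trichotomy j j' with h | h | h
  · exact absurd ⟨h3, h4⟩ (g5 j h1 h)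
  · exact h
  · exact absurd ⟨g3, g4⟩ (h5 j' g1 h)

theorem IsRising.isFirstPair {u v : Perm (Fin n)} {l : List (Perm (Fin n))} {i j : Fin n}
    (hij : IsCoverPair u i j) (hl : IsSaturated v u (u :: u * swap i j :: l))
    (hr : IsRising edgeLabel (u :: u * swap i j :: l)) : IsFirstPair u v i j := by
  induction l generalizing u i j with
  | nil =>
    obtain rfl : u * swap i j = v := by
      cases hl with
      | cons _ h => cases h; rfl
    obtain ⟨h1, h2, h3⟩ := hij
    have hl := mul_swap_apply_left u i j
    refine ⟨h1, fun k hk => (mul_swap_apply_of_ne u hk.ne (hk.trans h1).ne).symm, h2,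
      hl.ge, fun k hk hk' hb => h3 k hk hk' ⟨hb.1, lt_of_le_of_ne (hl ▸ hb.2) ?_⟩⟩
    exact fun he => hk'.ne (u.injective he)
  | cons x l ih =>
    cases hl with
    | cons _ hl =>
      cases hr with
      | cons hlt hr =>
        obtain ⟨a, b, hab, rfl⟩ := covBy_iff.mp (by cases hl; assumption)
        rw [edgeLabel_lt_iff hij.1 hab.1] at hlt
        obtain ⟨g1, g2, g3, g4, g5⟩ := ih hab hl hr
        obtain ⟨h1, h2, h3⟩ := hij
        have hui := mul_swap_apply_left u i j
        have hne := fun k => mul_swap_apply_of_ne u (i := i) (j := j) (k := k)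
        have hinj : ∀ k, k < j → u k ≠ u j := fun k hk he => hk.ne (u.injective he)
        refine ⟨h1, fun k hk => ?_, h2, ?_, fun k hk hk' hb => ?_⟩
        · rw [← hne k hk.ne (hk.trans h1).ne]
          exact g2 k (by omega)
        · rcases hlt with h | ⟨rfl, h⟩
          · rw [← hui, g2 i h]
          · rw [← hui]
            exact (g3.trans_le g4).le
        · have := h3 k hk hk'
          have := hinj k hk'
          have hjk : u j < u k := by omega
          rcases hlt with h | ⟨rfl, h⟩
          · have := g2 i h
            omega
          · refine g5 k hk (hk'.trans h) ?_
            rw [hui, hne k hk.ne' hk'.ne]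
            exact ⟨hjk, hb.2⟩

theorem IsRising.eq_of_isSaturated {u w w' v : Perm (Fin n)} {l l' : List (Perm (Fin n))}
    (h : IsSaturated v u (u :: w :: l)) (hr : IsRising edgeLabel (u :: w :: l))
    (h' : IsSaturated v u (u :: w' :: l')) (hr' : IsRising edgeLabel (u :: w' :: l')) :
    w = w' := by
  obtain ⟨i, j, hij, rfl⟩ := covBy_iff.mp (show u ⋖ w by cases h; assumption)
  obtain ⟨a, b, hab, rfl⟩ := covBy_iff.mp (show u ⋖ w' by cases h'; assumption)
  obtain ⟨rfl, rfl⟩ := (hr.isFirstPair hij h).unique (hr'.isFirstPair hab h')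
  rfl

/-- The position `i` is the first where `u` and `v` differ, and `j` is the first position after
`i` at which the value of `v` belongs to the interval `[u i, v i)`. -/
structure IsFirstPair' (u v : Perm (Fin n)) (i j : Fin n) : Prop where
  lt : i < j
  eq_of_lt : ∀ k < i, u k = v k
  le_apply : u i ≤ v j
  apply_lt : v j < v i
  not_between : ∀ k, i < k → k < j → ¬ (u i ≤ v k ∧ v k < v i)

theorem IsFirstPair'.unique {u v : Perm (Fin n)} {i j i' j' : Fin n} (h : IsFirstPair' u v i j)
    (h' : IsFirstPair' u v i' j') : i = i' ∧ j = j' := by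
  obtain ⟨h1, h2, h3, h4, h5⟩ := h
  obtain ⟨g1, g2, g3, g4, g5⟩ := h'
  have hi : i = i' := by
    rcases lt_trichotomy i i' with h | h | h
    · exact absurd (g2 i h) (h3.trans_lt h4).ne
    · exact h
    · exact absurd (h2 i' h) (g3.trans_lt g4).ne
  subst hi
  refine ⟨rfl, ?_⟩
  rcases lt_trichotomy j j' with h | h | h
  · exact absurd ⟨h3, h4⟩ (g5 j h1 h)
  · exact h
  · exact absurd ⟨g3, g4⟩ (h5 j' g1 h)

theorem lt_or_lt_of_not_edgeLabel_lt {x : Perm (Fin n)} {a b c d : Fin n}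
    (hab : IsCoverPair x a b) (hcd : IsCoverPair (x * swap a b) c d)
    (h : ¬ edgeLabel x (x * swap a b) <
      edgeLabel (x * swap a b) (x * swap a b * swap c d)) : c < a ∨ c = a ∧ d < b := by
  rw [edgeLabel_lt_iff hab.1 hcd.1] at h
  have hne : ¬ (c = a ∧ d = b) := by
    rintro ⟨rfl, rfl⟩
    have := hcd.2.1
    rw [mul_swap_apply_left, mul_swap_apply_right] at this
    exact absurd this hab.2.1.not_gt
  omega

theorem IsCoverPair.isFirstPair' {x : Perm (Fin n)} {a b c d : Fin n}
    (hab : IsCoverPair x a b) (hcd : IsCoverPair (x * swap a b) c d)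
    (h : c < a ∨ c = a ∧ d < b) : IsFirstPair' x (x * swap a b * swap c d) c d := by
  obtain ⟨h1, h2, h3⟩ := hab
  obtain ⟨g1, g2, g3⟩ := hcd
  have ya := mul_swap_apply_left x a b
  have yb := mul_swap_apply_right x a b
  have yk := fun k => mul_swap_apply_of_ne x (i := a) (j := b) (k := k)
  have hinj : ∀ k l, x k = x l → k = l := fun k l he => x.injective he
  generalize x * swap a b = y at *
  have zc := mul_swap_apply_left y c d
  have zd := mul_swap_apply_right y c d
  have zk := fun k => mul_swap_apply_of_ne y (i := c) (j := d) (k := k)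
  generalize y * swap c d = z at *
  refine ⟨g1, ?_, ?_, ?_, ?_⟩ <;> grind

theorem eq_of_not_edgeLabel_lt {x y y' z : Perm (Fin n)} (hxy : x ⋖ y) (hyz : y ⋖ z)
    (h : ¬ edgeLabel x y < edgeLabel y z) (hxy' : x ⋖ y') (hyz' : y' ⋖ z)
    (h' : ¬ edgeLabel x y' < edgeLabel y' z) : y = y' := by
  obtain ⟨a, b, hab, rfl⟩ := covBy_iff.mp hxy
  obtain ⟨c, d, hcd, rfl⟩ := covBy_iff.mp hyz
  obtain ⟨a', b', hab', rfl⟩ := covBy_iff.mp hxy'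
  obtain ⟨c', d', hcd', hz⟩ := covBy_iff.mp hyz'
  have h1 := hab.isFirstPair' hcd (lt_or_lt_of_not_edgeLabel_lt hab hcd h)
  rw [hz] at h' h1
  obtain ⟨rfl, rfl⟩ :=
    h1.unique (hab'.isFirstPair' hcd' (lt_or_lt_of_not_edgeLabel_lt hab' hcd' h'))
  exact mul_right_cancel hz

theorem mul_swap_mul_swap_of_disjoint (x : Perm (Fin n)) {a b c d : Fin n} (hac : a ≠ c)
    (had : a ≠ d) (hbc : b ≠ c) (hbd : b ≠ d) :
    x * swap c d * swap a b = x * swap a b * swap c d := by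
  rw [mul_assoc, mul_assoc]
  congr 1
  ext t
  simp only [Perm.mul_apply, swap_apply_def]
  grind

theorem mul_swap_mul_swap_rotate (x : Perm (Fin n)) {a b c : Fin n} (hab : a ≠ b) (hac : a ≠ c)
    (hbc : b ≠ c) : x * swap a b * swap b c = x * swap a c * swap a b := by
  rw [mul_assoc, mul_assoc]
  congr 1
  ext t
  simp only [Perm.mul_apply, swap_apply_def]
  grind

theorem IsCoverPair.exists_of_disjoint {x : Perm (Fin n)} {a b c d : Fin n}
    (hab : IsCoverPair x a b) (hcd : IsCoverPair (x * swap a b) c d) (hca : c < a) (hda : d ≠ a)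
    (hdb : d ≠ b) : IsCoverPair x c d ∧ IsCoverPair (x * swap c d) a b := by
  obtain ⟨h1, h2, h3⟩ := hab
  obtain ⟨g1, g2, g3⟩ := hcd
  have ya := mul_swap_apply_left x a b
  have yb := mul_swap_apply_right x a b
  have yk := fun k => mul_swap_apply_of_ne x (i := a) (j := b) (k := k)
  have wc := mul_swap_apply_left x c d
  have wd := mul_swap_apply_right x c d
  have wk := fun k => mul_swap_apply_of_ne x (i := c) (j := d) (k := k)
  have hinj : ∀ k l, x k = x l → k = l := fun k l he => x.injective he
  generalize x * swap a b = y at *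
  generalize x * swap c d = w at *
  refine ⟨⟨g1, ?_, ?_⟩, ⟨h1, ?_, ?_⟩⟩ <;> grind

theorem IsCoverPair.exists_of_left_eq {x : Perm (Fin n)} {a b d : Fin n}
    (hab : IsCoverPair x a b) (hcd : IsCoverPair (x * swap a b) a d) (hdb : d < b) :
    IsCoverPair x a d ∧ IsCoverPair (x * swap a d) d b := by
  obtain ⟨h1, h2, h3⟩ := hab
  obtain ⟨g1, g2, g3⟩ := hcd
  have ya := mul_swap_apply_left x a b
  have yb := mul_swap_apply_right x a b
  have yk := fun k => mul_swap_apply_of_ne x (i := a) (j := b) (k := k)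
  have wa := mul_swap_apply_left x a d
  have wd := mul_swap_apply_right x a d
  have wk := fun k => mul_swap_apply_of_ne x (i := a) (j := d) (k := k)
  have hinj : ∀ k l, x k = x l → k = l := fun k l he => x.injective he
  generalize x * swap a b = y at *
  generalize x * swap a d = w at *
  refine ⟨⟨g1, ?_, ?_⟩, ⟨hdb, ?_, ?_⟩⟩ <;> grind

theorem IsCoverPair.exists_of_eq_left_of_lt {x : Perm (Fin n)} {a b c : Fin n}
    (hab : IsCoverPair x a b) (hcd : IsCoverPair (x * swap a b) c a) (hx : x c < x a) :
    IsCoverPair x c a ∧ IsCoverPair (x * swap c a) c b := by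
  obtain ⟨h1, h2, h3⟩ := hab
  obtain ⟨g1, g2, g3⟩ := hcd
  have ya := mul_swap_apply_left x a b
  have yb := mul_swap_apply_right x a b
  have yk := fun k => mul_swap_apply_of_ne x (i := a) (j := b) (k := k)
  have wc := mul_swap_apply_left x c a
  have wa := mul_swap_apply_right x c a
  have wk := fun k => mul_swap_apply_of_ne x (i := c) (j := a) (k := k)
  have hinj : ∀ k l, x k = x l → k = l := fun k l he => x.injective he
  generalize x * swap a b = y at *
  generalize x * swap c a = w at *
  refine ⟨⟨g1, ?_, ?_⟩, ⟨g1.trans h1, ?_, ?_⟩⟩ <;> grind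

theorem IsCoverPair.exists_of_eq_left_of_gt {x : Perm (Fin n)} {a b c : Fin n}
    (hab : IsCoverPair x a b) (hcd : IsCoverPair (x * swap a b) c a) (hx : x a < x c) :
    IsCoverPair x c b ∧ IsCoverPair (x * swap c b) a b := by
  obtain ⟨h1, h2, h3⟩ := hab
  obtain ⟨g1, g2, g3⟩ := hcd
  have ya := mul_swap_apply_left x a b
  have yb := mul_swap_apply_right x a b
  have yk := fun k => mul_swap_apply_of_ne x (i := a) (j := b) (k := k)
  have wc := mul_swap_apply_left x c b
  have wb := mul_swap_apply_right x c b
  have wk := fun k => mul_swap_apply_of_ne x (i := c) (j := b) (k := k)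
  have hinj : ∀ k l, x k = x l → k = l := fun k l he => x.injective he
  generalize x * swap a b = y at *
  generalize x * swap c b = w at *
  refine ⟨⟨g1.trans h1, ?_, ?_⟩, ⟨h1, ?_, ?_⟩⟩ <;> grind

theorem IsCoverPair.exists_of_eq_right {x : Perm (Fin n)} {a b c : Fin n}
    (hab : IsCoverPair x a b) (hcd : IsCoverPair (x * swap a b) c b) (hca : c < a) :
    IsCoverPair x c a ∧ IsCoverPair (x * swap c a) a b := by
  obtain ⟨h1, h2, h3⟩ := hab
  obtain ⟨g1, g2, g3⟩ := hcd
  have ya := mul_swap_apply_left x a b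
  have yb := mul_swap_apply_right x a b
  have yk := fun k => mul_swap_apply_of_ne x (i := a) (j := b) (k := k)
  have wc := mul_swap_apply_left x c a
  have wa := mul_swap_apply_right x c a
  have wk := fun k => mul_swap_apply_of_ne x (i := c) (j := a) (k := k)
  have hinj : ∀ k l, x k = x l → k = l := fun k l he => x.injective he
  generalize x * swap a b = y at *
  generalize x * swap c a = w at *
  refine ⟨⟨hca, ?_, ?_⟩, ⟨h1, ?_, ?_⟩⟩ <;> grind

theorem exists_isCoverPair_of_lt {x : Perm (Fin n)} {a b c d : Fin n} (hab : IsCoverPair x a b)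
    (hcd : IsCoverPair (x * swap a b) c d) (h : c < a ∨ c = a ∧ d < b) :
    ∃ i j k l, IsCoverPair x i j ∧ IsCoverPair (x * swap i j) k l ∧
      x * swap i j * swap k l = x * swap a b * swap c d ∧
      (i < k ∨ i = k ∧ j < l) ∧ (i < a ∨ i = a ∧ j < b) := by
  have h1 := hab.1
  have g1 := hcd.1
  rcases h with hca | ⟨rfl, hdb⟩
  · by_cases hda : d = a
    · subst hda
      rcases lt_or_gt_of_ne (fun he => hca.ne (x.injective he)) with hx | hx
      · obtain ⟨p, q⟩ := hab.exists_of_eq_left_of_lt hcd hx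
        refine ⟨_, _, _, _, p, q, ?_, Or.inr ⟨rfl, h1⟩, Or.inl hca⟩
        rw [swap_comm c d]
        exact mul_swap_mul_swap_rotate x hca.ne' h1.ne (hca.trans h1).ne
      · obtain ⟨p, q⟩ := hab.exists_of_eq_left_of_gt hcd hx
        refine ⟨_, _, _, _, p, q, ?_, Or.inl hca, Or.inl hca⟩
        rw [swap_comm c b, swap_comm d b, swap_comm c d]
        exact (mul_swap_mul_swap_rotate x h1.ne' (hca.trans h1).ne' hca.ne').symm
    · by_cases hdb : d = b
      · subst hdb
        obtain ⟨p, q⟩ := hab.exists_of_eq_right hcd hca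
        refine ⟨_, _, _, _, p, q, ?_, Or.inl hca, Or.inl hca⟩
        rw [swap_comm c d, swap_comm c a]
        exact (mul_swap_mul_swap_rotate x h1.ne hca.ne' g1.ne').symm
      · obtain ⟨p, q⟩ := hab.exists_of_disjoint hcd hca hda hdb
        exact ⟨_, _, _, _, p, q, mul_swap_mul_swap_of_disjoint x hca.ne' (Ne.symm hda)
          (hca.trans h1).ne' (Ne.symm hdb), Or.inl hca, Or.inl hca⟩
  · obtain ⟨p, q⟩ := hab.exists_of_left_eq hcd hdb
    exact ⟨_, _, _, _, p, q, mul_swap_mul_swap_rotate x g1.ne h1.ne hdb.ne, Or.inl g1,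
      Or.inr ⟨rfl, hdb⟩⟩

theorem exists_isFlipAt {x y z : Perm (Fin n)} (hxy : x ⋖ y) (hyz : y ⋖ z)
    (h : ¬ edgeLabel x y < edgeLabel y z) :
    ∃ y', edgeLabel x y' < edgeLabel x y ∧ IsFlipAt x y z y' := by
  obtain ⟨a, b, hab, rfl⟩ := covBy_iff.mp hxy
  obtain ⟨c, d, hcd, rfl⟩ := covBy_iff.mp hyz
  obtain ⟨i, j, k, l, hij, hkl, hz, hlt, hlt'⟩ :=
    exists_isCoverPair_of_lt hab hcd (lt_or_lt_of_not_edgeLabel_lt hab hcd h)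
  rw [← edgeLabel_lt_iff (x := x) (y := x * swap i j) hij.1 hkl.1, hz] at hlt
  rw [← edgeLabel_lt_iff (x := x) (y := x) hij.1 hab.1] at hlt'
  have hkl' := hkl.covBy
  rw [hz] at hkl'
  refine ⟨x * swap i j, hlt', hxy, hyz, hij.covBy, hkl', ?_, fun w hxw hwz hw => ?_⟩
  · intro he
    rw [he] at hlt'
    exact lt_irrefl _ hlt'
  · by_cases hr : edgeLabel x w < edgeLabel w (x * swap a b * swap c d)
    · exact IsRising.eq_of_isSaturated (.cons hxw (.cons hwz .nil)) (.cons hr (.pair _ _))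
        (.cons hij.covBy (.cons hkl' .nil)) (.cons hlt (.pair _ _))
    · exact absurd (eq_of_not_edgeLabel_lt hxw hwz hr hxy hyz h) hw

end Bruhat

theorem mainTheorem10 (n : ℕ) (u v : Equiv.Perm (Fin n)) (huv : u ≤ v)
    (C D : Flag (Set.Icc u v)) :
    Relation.ReflTransGen Bruhat.IsFlip C D := by
  obtain ⟨l, hl, hC⟩ := C.exists_isSaturated huv
  obtain ⟨m, hm, hD⟩ := D.exists_isSaturated huv
  refine hl.reflTransGen_isFlip (hl.reflTransGen_listFlip (lab := Bruhat.edgeLabel) ?_ ?_ hm) hC hD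
  · exact fun _ _ _ => Bruhat.exists_isFlipAt
  · exact Bruhat.IsRising.eq_of_isSaturated
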